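/- **Setting.** Let $n\ge 1$ and $p,q\ge 1$ with $p+q=n+1$. Let $M\subset\mathbb R^n$ be covered by a finite simplicial mesh $\mathcal T_h$ and carry a continuous Riemannian metric; $(\cdot,\cdot)_M$ is the $L^2$ inner product of $k$-forms and $\langle\alpha|\beta\rangle_{\partial M}=\int_{\partial M}\operatorname{tr}\alpha\wedge\operatorname{tr}\beta$. For a polynomial degree $s\ge1$ let $\mathcal V^k=\mathcal P_s^-\Omega^k(\mathcal T_h)$ be the trimmed polynomial finite element space, with a finite element basis $(\phi^k_i)$ dual to the usual degrees of freedom $u\mapsto\int_f \operatorname{tr}u\wedge\zeta$, where $f$ is a simplex of the mesh of dimension $d\ge k$ and $\zeta\in\mathcal P_{s+k-d-1}\Lambda^{d-k}(f)$. Outer-oriented objects carry a hat. Let $\widehat C,\widehat E,C,E$ be bounded, symmetric, uniformly positive operators on the $L^2$ spaces of forms of degree $p$, $p-1$, $q-1$, $q$ respectively. **Matrices.** Put $[M_{\widehat C}]_i^j=(\phi^p_i,\widehat C\phi^p_j)_M$, and likewise $M_{\widehat E}$, $M_C$, $M_E$ in degrees $p-1$, $q-1$, $q$; $[D^k]_i^j=(\phi_i^{k+1},d\phi_j^k)_M$.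 Let $T^k$ be the $0/1$ matrix that selects the boundary degrees of freedom (those attached to simplices on $\partial M$), let $\psi^k_l$ be the trace of the basis form of the boundary degree of freedom $l$, and put $[\Psi^k]_l^m=\langle\psi_l^{n-k-1}|\psi_m^k\rangle_{\partial M}$, $B^k=(T^{n-k-1})^\top\Psi^k$. The boundary degrees of freedom of the $(p-1)$-forms, and those of the $(q-1)$-forms, are split into two complementary index sets $\Gamma_1,\Gamma_2$ (any such splitting is allowed); $I$ denotes the interior degrees of freedom. $[A]_R^S$ is the submatrix with rows $R$ and columns $S$ (an omitted index means all). **Time stepping.** Let $\Delta t=T_{\rm end}/N_t$ with $T_{\rm end}>0$, $N_t\ge1$, and $x_{k+1/2}=\tfrac12(x_{k+1}+x_k)$ for every sequence $x$. Let input sequences $u_{1,k}\in\mathbb R^{\Gamma_1}$ (in degree $q-1$) and $\hat u_{2,k}\in\mathbb R^{\Gamma_2}$ (in degree $p-1$) be given. *Primal recursion.* The vectors $\hat e_{1,k}$ (degree $p$) and $\hat e_{2,k}$ (degree $p-1$) satisfy $(-1)^p[\hat e_{2,k}]_{\Gamma_2}=\hat u_{2,k}$ for $0\le k\le N_t$ and,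 for $0\le k<N_t$, with $F=I\cup\Gamma_1$, $\sigma=(-1)^p$, $D=D^{p-1}$, $$\begin{bmatrix}M_{\widehat C}&-\tfrac{\sigma\Delta t}2[D]^F\\ \tfrac{\sigma\Delta t}2[D^\top]_F&[M_{\widehat E}]_F^F\end{bmatrix}\begin{pmatrix}\hat e_{1,k+1}\\ [\hat e_{2,k+1}]_F\end{pmatrix}=\begin{bmatrix}M_{\widehat C}&\tfrac{\sigma\Delta t}2[D]^F\\ -\tfrac{\sigma\Delta t}2[D^\top]_F&[M_{\widehat E}]_F^F\end{bmatrix}\begin{pmatrix}\hat e_{1,k}\\ [\hat e_{2,k}]_F\end{pmatrix}-\sigma\begin{bmatrix}0\\ [M_{\widehat E}]_F^{\Gamma_2}\end{bmatrix}(\hat u_{2,k+1}-\hat u_{2,k})+\Delta t\begin{bmatrix}[D]^{\Gamma_2}&0\\0&\sigma[B^{q-1}]_F^{\Gamma_1}\end{bmatrix}\begin{pmatrix}\hat u_{2,k+1/2}\\u_{1,k+1/2}\end{pmatrix}.$$ *Dual recursion.* The vectors $e_{1,k}$ (degree $q-1$) and $e_{2,k}$ (degree $q$) satisfy $[e_{1,k}]_{\Gamma_1}=u_{1,k}$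 for $0\le k\le N_t$ and, for $0\le k<N_t$, with $F=I\cup\Gamma_2$, $D=D^{q-1}$, $$\begin{bmatrix}[M_C]_F^F&-\tfrac{\Delta t}2[D^\top]_F\\ \tfrac{\Delta t}2[D]^F&M_E\end{bmatrix}\begin{pmatrix}[e_{1,k+1}]_F\\ e_{2,k+1}\end{pmatrix}=\begin{bmatrix}[M_C]_F^F&\tfrac{\Delta t}2[D^\top]_F\\ -\tfrac{\Delta t}2[D]^F&M_E\end{bmatrix}\begin{pmatrix}[e_{1,k}]_F\\ e_{2,k}\end{pmatrix}-\begin{bmatrix}[M_C]_F^{\Gamma_1}\\0\end{bmatrix}(u_{1,k+1}-u_{1,k})+\Delta t\begin{bmatrix}0&(-1)^{(p-1)(q-1)}[B^{p-1}]_F^{\Gamma_2}\\-[D]^{\Gamma_1}&0\end{bmatrix}\begin{pmatrix}u_{1,k+1/2}\\ \hat u_{2,k+1/2}\end{pmatrix}.$$ **Hamiltonians.** For coefficient vectors with discrete forms $\hat e_{i,h,k}$ and $e_{i,h,k}$ put $\widehat H_k=\tfrac12(\hat e_{1,h,k},\widehat C\hat e_{1,h,k})_M+\tfrac12(\hat e_{2,h,k},\widehat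 E\hat e_{2,h,k})_M$ and $H_k=\tfrac12(e_{1,h,k},Ce_{1,h,k})_M+\tfrac12(e_{2,h,k},Ee_{2,h,k})_M$. **Claim.** For every $0\le k<N_t$: every solution of the primal recursion satisfies $$\frac{\widehat H_{k+1}-\widehat H_k}{\Delta t}=(\hat u_{2,k+1/2})^\top\tilde y^{\,p-1}_{k+1/2}+(\hat y_{2,k+1/2})^\top[\Psi^{q-1}]_{\Gamma_1}^{\Gamma_1}u_{1,k+1/2},$$ and every solution of the dual recursion satisfies $$\frac{H_{k+1}-H_k}{\Delta t}=(u_{1,k+1/2})^\top\tilde y^{\,q-1}_{k+1/2}+(\hat u_{2,k+1/2})^\top[\Psi^{q-1}]_{\Gamma_2}^{\Gamma_2}y_{1,k+1/2},$$ where $\hat y_{2,k+1/2}=(-1)^p[\hat e_{2,k+1/2}]_{\Gamma_1}$, $y_{1,k+1/2}=[e_{1,k+1/2}]_{\Gamma_2}$ and $$\tilde y^{\,p-1}_{k+1/2}=(-1)^p[M_{\widehat E}]_{\Gamma_2}\frac{\hat e_{2,k+1}-\hat e_{2,k}}{\Delta t}+[(D^{p-1})^\top]_{\Gamma_2}\hat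 e_{1,k+1/2},\qquad \tilde y^{\,q-1}_{k+1/2}=[M_C]_{\Gamma_1}\frac{e_{1,k+1}-e_{1,k}}{\Delta t}-[(D^{q-1})^\top]_{\Gamma_1}e_{2,k+1/2}.$$ -/

import Mathlib

open MeasureTheory Matrix
open scoped Classical

noncomputable section

namespace DualField

/-! ### Differential forms on Euclidean space -/

/-- The ambient Euclidean space. -/
abbrev Eucl (n : ℕ) := EuclideanSpace ℝ (Fin n)

/-- Alternating `k`-linear forms on the ambient space. -/
abbrev Alt (n k : ℕ) := Eucl n [⋀^Fin k]→L[ℝ] ℝ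

/-- Differential `k`-forms on the ambient space. The orientation of the ambient space identifies
outer-oriented with inner-oriented forms. -/
abbrev Form (n k : ℕ) := Eucl n → Alt n k

/-- The wedge product of two alternating forms (the sum over shuffles). -/
def wedge {n k l m : ℕ} (h : k + l = m) (α : Alt n k) (β : Alt n l) :
    Eucl n [⋀^Fin m]→ₗ[ℝ] ℝ :=
  ((LinearMap.mul' ℝ ℝ).compAlternatingMap
    (α.toAlternatingMap.domCoprod β.toAlternatingMap)).domDomCongr
      (finSumFinEquiv.trans (finCongr h))

/-- The integral of (the trace of) a `d`-form over the oriented `d`-simplex `[v 0, …, v d]`: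
the form is pulled back to the standard simplex by the affine parametrization. -/
def simplexIntegral {n d : ℕ} (v : Fin (d + 1) → Eucl n)
    (ω : Eucl n → Eucl n [⋀^Fin d]→ₗ[ℝ] ℝ) : ℝ :=
  ∫ t in {t : Fin d → ℝ | (∀ i, 0 ≤ t i) ∧ ∑ i, t i ≤ 1},
    ω (v 0 + ∑ i, t i • (v i.succ - v 0)) (fun i => v i.succ - v 0)

/-! ### The trimmed polynomial forms -/

/-- `P_r Λ^k`: the `k`-forms with polynomial coefficients of degree at most `r`. -/
def polyForms (n r k : ℕ) : Submodule ℝ (Form n k) :=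
  Submodule.span ℝ {ω | ∃ (P : MvPolynomial (Fin n) ℝ) (c : Alt n k), P.totalDegree ≤ r ∧
    ω = fun x => MvPolynomial.eval (fun i => x i) P • c}

/-- The Koszul operator `(κ ω)_x = ω_x (x, ·, …, ·)`. -/
def koszul (n k : ℕ) : Form n (k + 1) →ₗ[ℝ] Form n k where
  toFun ω := fun x => ContinuousAlternatingMap.curryLeft (ω x) x
  map_add' _ _ := rfl
  map_smul' _ _ := rfl

/-- `P_s^- Λ^k = P_{s-1} Λ^k + κ P_{s-1} Λ^{k+1}`, for `1 ≤ s`. -/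
def trimmed (n s k : ℕ) : Submodule ℝ (Form n k) :=
  polyForms n (s - 1) k ⊔ (polyForms n (s - 1) (k + 1)).map (koszul n k)

theorem continuous_of_mem_polyForms {n r k : ℕ} {ω : Form n k} (h : ω ∈ polyForms n r k) :
    Continuous ω := by
  refine Submodule.span_induction (p := fun ω _ => Continuous ω) ?_ ?_ ?_ ?_ h
  · rintro ω ⟨P, c, -, rfl⟩
    have h1 : Continuous fun x : Eucl n => MvPolynomial.eval (fun i => x i) P :=
      (MvPolynomial.continuous_eval P).comp (continuous_pi fun i => by fun_prop)
    exact h1.smul (continuous_const (y := c))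
  · exact continuous_const
  · intro x y _ _ hx hy
    exact hx.add hy
  · intro a x _ hx
    exact hx.const_smul a

theorem continuous_of_mem_trimmed {n s k : ℕ} {ω : Form n k} (h : ω ∈ trimmed n s k) :
    Continuous ω := by
  obtain ⟨α, hα, β, ⟨γ, hγ, rfl⟩, rfl⟩ := Submodule.mem_sup.1 h
  refine (continuous_of_mem_polyForms hα).add ?_
  have h1 : Continuous fun x => (γ x).curryLeft :=
    (ContinuousAlternatingMap.curryLeftLI (𝕜 := ℝ) (E := Eucl n) (F := ℝ)
      (n := k)).continuous.comp (continuous_of_mem_polyForms hγ)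
  exact h1.clm_apply continuous_id

/-! ### Meshes and finite element spaces -/

/-- A simplicial mesh of an `n`-dimensional domain: a finite simplicial complex in which every
simplex is a face of an `n`-simplex. -/
structure Mesh (n : ℕ) where
  complex : Geometry.SimplicialComplex ℝ (Eucl n)
  finite : complex.faces.Finite
  pure : ∀ f ∈ complex.faces, ∃ T ∈ complex.faces, f ⊆ T ∧ T.card = n + 1

namespace Mesh

variable {n : ℕ} (𝓣 : Mesh n)

/-- The domain `M` covered by the mesh. -/
def domain : Set (Eucl n) := 𝓣.complex.space

/-- The cells of the mesh, that is, its `n`-simplices. -/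
def cells : Finset (Finset (Eucl n)) := 𝓣.finite.toFinset.filter fun T => T.card = n + 1

/-- The type of cells. -/
abbrev Cell := {T : Finset (Eucl n) // T ∈ 𝓣.cells}

/-- The boundary facets: the `(n-1)`-simplices that belong to exactly one cell. -/
def IsBdryFacet (F : Finset (Eucl n)) : Prop :=
  F ∈ 𝓣.complex.faces ∧ F.card = n ∧ ∃! T, T ∈ 𝓣.cells ∧ F ⊆ T

/-- The finite element space `V_{s,h}^k = P_s^- Ω^k(𝓣)`: one trimmed polynomial form per cell,
with single-valued traces on the simplices shared by two cells. -/
def feSpace (s k : ℕ) : Submodule ℝ (𝓣.Cell → Form n k) where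
  carrier := {u | (∀ T, u T ∈ trimmed n s k) ∧
    ∀ T T' : 𝓣.Cell, ∀ x ∈ convexHull ℝ ((T.1 : Set (Eucl n)) ∩ T'.1),
      ∀ v : Fin k → Eucl n, (∀ i, v i ∈ vectorSpan ℝ ((T.1 : Set (Eucl n)) ∩ T'.1)) →
        u T x v = u T' x v}
  add_mem' := by
    rintro u w ⟨hu, hu'⟩ ⟨hw, hw'⟩
    refine ⟨fun T => add_mem (hu T) (hw T), fun T T' x hx v hv => ?_⟩
    simp [hu' T T' x hx v hv, hw' T T' x hx v hv]
  zero_mem' := ⟨fun _ => zero_mem _, fun _ _ _ _ _ _ => rfl⟩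
  smul_mem' := by
    rintro c u ⟨hu, hu'⟩
    refine ⟨fun T => Submodule.smul_mem _ c (hu T), fun T T' x hx v hv => ?_⟩
    simp [hu' T T' x hx v hv]

/-- The form on the domain that a family of forms on the cells defines (almost everywhere). -/
def piecewise {k : ℕ} (u : 𝓣.Cell → Form n k) : Form n k := fun x =>
  ∑ T : 𝓣.Cell, (interior (convexHull ℝ (T.1 : Set (Eucl n)))).indicator (u T) x

/-- The space `L² Ω^k(M)`. -/
abbrev L2 (k : ℕ) := Lp (Alt n k) 2 (volume.restrict 𝓣.domain)

theorem isCompact_domain : IsCompact 𝓣.domain := by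
  have h : 𝓣.domain = ⋃ f ∈ 𝓣.complex.faces, convexHull ℝ (f : Set (Eucl n)) := rfl
  rw [h]
  exact 𝓣.finite.isCompact_biUnion fun f _ => f.finite_toSet.isCompact_convexHull ℝ

theorem memLp_sum_indicator {X F ι : Type*} [MeasurableSpace X] [NormedAddCommGroup F]
    [Fintype ι] {μ : Measure X} {A : ι → Set X} {f : ι → X → F} (hf : ∀ i, MemLp (f i) 2 μ)
    (hA : ∀ i, MeasurableSet (A i)) : MemLp (fun x => ∑ i, (A i).indicator (f i) x) 2 μ :=
  memLp_finsetSum Finset.univ fun i _ => (hf i).indicator (hA i)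

theorem memLp_of_continuous {k : ℕ} {ω : Form n k} (h : Continuous ω) :
    MemLp ω 2 (volume.restrict 𝓣.domain) := by
  have hfin : IsFiniteMeasure (volume.restrict 𝓣.domain) :=
    isFiniteMeasure_restrict.2 𝓣.isCompact_domain.measure_lt_top.ne
  obtain ⟨c, hc⟩ := 𝓣.isCompact_domain.exists_bound_of_continuousOn h.continuousOn
  exact MemLp.of_bound h.aestronglyMeasurable c
    ((ae_restrict_iff' 𝓣.isCompact_domain.measurableSet).2 (Filter.Eventually.of_forall hc))

theorem memLp_piecewise {k : ℕ} {u : 𝓣.Cell → Form n k} (h : ∀ T, Continuous (u T)) :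
    MemLp (𝓣.piecewise u) 2 (volume.restrict 𝓣.domain) :=
  memLp_sum_indicator (fun T => 𝓣.memLp_of_continuous (h T))
    fun _ => isOpen_interior.measurableSet

/-- The `L²` class of a discrete form. -/
def toL2 {s k : ℕ} (u : 𝓣.feSpace s k) : 𝓣.L2 k :=
  (𝓣.memLp_piecewise fun T => continuous_of_mem_trimmed (u.2.1 T)).toLp (𝓣.piecewise u.1)

/-- The exterior derivative of a discrete form, taken cell by cell. -/
def d {s k : ℕ} (u : 𝓣.feSpace s k) : 𝓣.Cell → Form n (k + 1) := fun T => extDeriv (u.1 T)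

/-- A (continuous) Riemannian metric on the domain, in Cartesian coordinates. -/
structure Metric where
  toMatrix : Eucl n → Matrix (Fin n) (Fin n) ℝ
  posDef : ∀ x ∈ 𝓣.domain, (toMatrix x).PosDef
  continuousOn : ∀ i j, ContinuousOn (fun x => toMatrix x i j) 𝓣.domain

variable {𝓣}

/-- The pointwise inner product of `k`-forms. The sum runs over all multi-indices, so that it
is divided by `k!`. -/
def Metric.pointwise (g : 𝓣.Metric) {k : ℕ} (x : Eucl n) (α β : Alt n k) : ℝ :=
  (1 / (k.factorial : ℝ)) * ∑ I : Fin k → Fin n, ∑ J : Fin k → Fin n,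
    (∏ r, (g.toMatrix x)⁻¹ (I r) (J r)) *
      α (fun r => EuclideanSpace.single (I r) 1) * β (fun r => EuclideanSpace.single (J r) 1)

/-- The `L²` inner product of `k`-forms. -/
def Metric.inner (g : 𝓣.Metric) {k : ℕ} (α β : Form n k) : ℝ :=
  ∫ x in 𝓣.domain, g.pointwise x (α x) (β x) * √(g.toMatrix x).det

/-- A material tensor on `k`-forms: an operator on `L² Ω^k(M)` that is bounded, symmetric and
bounded from below by a positive constant. -/
structure Material (g : 𝓣.Metric) (k : ℕ) where
  op : 𝓣.L2 k →L[ℝ] 𝓣.L2 k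
  symm : ∀ α β : 𝓣.L2 k, g.inner α (op β) = g.inner (op α) β
  coercive : ∃ c : ℝ, 0 < c ∧ ∀ α : 𝓣.L2 k, c * g.inner α α ≤ g.inner α (op α)

variable (𝓣)

/-- A finite element basis of `V_{s,h}^k`. Every degree of freedom `i` belongs to a simplex
`f = [vert i 0, …, vert i d]` of the mesh, of dimension `d = k + codeg i`, and is the functional
`u ↦ ∫_f tr u ∧ ζ_i` for a weight `ζ_i ∈ P_{s + k - d - 1} Λ^{d - k}`. The basis is dual to the
degrees of freedom. -/
structure FEBasis (s k : ℕ) where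
  N : ℕ
  φ : Module.Basis (Fin N) ℝ (𝓣.feSpace s k)
  codeg : Fin N → ℕ
  codeg_lt : ∀ i, codeg i < s
  vert : ∀ i, Fin (k + codeg i + 1) → Eucl n
  vert_injective : ∀ i, Function.Injective (vert i)
  vert_mem : ∀ i, Finset.univ.image (vert i) ∈ 𝓣.complex.faces
  ζ : ∀ i, Form n (codeg i)
  ζ_mem : ∀ i, ζ i ∈ polyForms n (s - codeg i - 1) (codeg i)
  dual : ∀ i j, ∀ T : 𝓣.Cell, Finset.univ.image (vert i) ⊆ T.1 →
    simplexIntegral (vert i) (fun x => wedge rfl ((φ j).1 T x) (ζ i x)) = if i = j then 1 else 0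

variable {𝓣}

namespace FEBasis

variable {s k : ℕ} (V : 𝓣.FEBasis s k)

/-- The discrete form with given coefficients. -/
def form (e : Fin V.N → ℝ) : 𝓣.feSpace s k := ∑ i, e i • V.φ i

/-- The degree of freedom `i` lies on the boundary. -/
def IsBdry (i : Fin V.N) : Prop :=
  ∃ F, 𝓣.IsBdryFacet F ∧ Finset.univ.image (V.vert i) ⊆ F

/-- The index set of the boundary degrees of freedom. -/
abbrev BdryIdx := {i : Fin V.N // V.IsBdry i}

/-- The degrees of freedom outside a set `Γ` of boundary degrees of freedom. -/
abbrev Rest (Γ : Set V.BdryIdx) := {i : Fin V.N // ∀ h : V.IsBdry i, (⟨i, h⟩ : V.BdryIdx) ∉ Γ}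

/-- The inclusion of a set `Γ` of boundary degrees of freedom into all degrees of freedom. -/
def incl (Γ : Set V.BdryIdx) (l : Γ) : Fin V.N := l.1.1

/-- The trace matrix `T`. -/
def trace : Matrix V.BdryIdx (Fin V.N) ℝ := fun l i => if l.1 = i then 1 else 0

/-- The weighted mass matrix `M_C`, with entries `(φ_i, C φ_j)_M`. -/
def mass {g : 𝓣.Metric} (C : Material g k) : Matrix (Fin V.N) (Fin V.N) ℝ :=
  fun i j => g.inner (𝓣.toL2 (V.φ i)) (C.op (𝓣.toL2 (V.φ j)))

/-- The matrix `D`, with entries `(φ_i^{k+1}, d φ_j^k)_M`. -/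
def deriv (g : 𝓣.Metric) (W : 𝓣.FEBasis s (k + 1)) : Matrix (Fin W.N) (Fin V.N) ℝ :=
  fun i j => g.inner (𝓣.piecewise (W.φ i).1) (𝓣.piecewise (𝓣.d (V.φ j)))

end FEBasis

/-! ### The duality product on the boundary -/

/-- The sign of the simplex `[v 0, …, v m]` as a part of the boundary of the simplex with the
further vertex `w`: the outward vector `v 0 - w` comes first. -/
def bdrySign {m : ℕ} (w : Eucl (m + 1)) (v : Fin (m + 1) → Eucl (m + 1)) : ℝ :=
  Real.sign (Matrix.det (Matrix.of (Fin.cons (fun r => (v 0 - w) r)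
    (fun i r => (v i.succ - v 0) r)) : Matrix (Fin (m + 1)) (Fin (m + 1)) ℝ))

theorem card_erase {m : ℕ} {𝓣 : Mesh (m + 1)} (T : 𝓣.Cell) (w : {w // w ∈ T.1}) :
    (T.1.erase w.1).card = m + 1 := by
  have h : T.1.card = m + 1 + 1 := (Finset.mem_filter.1 T.2).2
  rw [Finset.card_erase_of_mem w.2, h]
  rfl

/-- An enumeration of the vertices of a face of a cell. (The signed integral below does not
depend on the choice.) -/
def facetVert {m : ℕ} {𝓣 : Mesh (m + 1)} (T : 𝓣.Cell) (w : {w // w ∈ T.1}) :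
    Fin (m + 1) → Eucl (m + 1) :=
  fun i => (((T.1.erase w.1).equivFinOfCardEq (card_erase T w)).symm i : Eucl (m + 1))

/-- The integral over `∂M`, with the induced orientation, of (the trace of) an `m`-form that is
given cell by cell. -/
def bdryIntegral {m : ℕ} {𝓣 : Mesh (m + 1)}
    (ω : 𝓣.Cell → Eucl (m + 1) → Eucl (m + 1) [⋀^Fin m]→ₗ[ℝ] ℝ) : ℝ :=
  ∑ T : 𝓣.Cell, ∑ w : {w // w ∈ T.1},
    if 𝓣.IsBdryFacet (T.1.erase w.1) then
      bdrySign w.1 (facetVert T w) * simplexIntegral (facetVert T w) (ω T)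
    else 0

/-- The duality product `⟨u | v⟩_{∂M} = ∫_{∂M} tr u ∧ tr v` of discrete forms. -/
def bdryDual {m s k l : ℕ} {𝓣 : Mesh (m + 1)} (h : k + l = m)
    (u : 𝓣.feSpace s k) (v : 𝓣.feSpace s l) : ℝ :=
  bdryIntegral fun T x => wedge h (u.1 T x) (v.1 T x)

/-- The boundary matrix `Ψ`, with entries `⟨ψ_l | ψ_m⟩_{∂M}`; here `ψ_l` is the trace of the
basis form of the boundary degree of freedom `l`. -/
def bdryMatrix {m s k l : ℕ} {𝓣 : Mesh (m + 1)} (h : k + l = m)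
    (V : 𝓣.FEBasis s k) (W : 𝓣.FEBasis s l) : Matrix V.BdryIdx W.BdryIdx ℝ :=
  fun i j => bdryDual h (V.φ i.1) (W.φ j.1)

/-- The boundary control matrix `B = Tᵀ Ψ`. -/
def control {m s k l : ℕ} {𝓣 : Mesh (m + 1)} (h : k + l = m)
    (V : 𝓣.FEBasis s k) (W : 𝓣.FEBasis s l) : Matrix (Fin V.N) W.BdryIdx ℝ :=
  V.traceᵀ * bdryMatrix h V W

end Mesh

/-! ### The dual-field discretization -/

/-- The midpoint value `x_{n+1/2}`. -/
def mid {ι : Type*} (x : ℕ → ι → ℝ) (n : ℕ) : ι → ℝ := (1 / 2 : ℝ) • (x (n + 1) + x n)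

/-- The data of a dual-field discretization in dimension `n = a + b + 1`, for the form degrees
`p = a + 1` and `q = b + 1` (so that `p + q = n + 1`). -/
structure Discretization (a b : ℕ) where
  mesh : Mesh (a + b + 1)
  metric : mesh.Metric
  /-- the polynomial degree -/
  s : ℕ
  one_le_s : 1 ≤ s
  /-- bases for the outer-oriented forms of degree `p` and `p - 1` -/
  Vp : mesh.FEBasis s (a + 1)
  Vp' : mesh.FEBasis s a
  /-- bases for the inner-oriented forms of degree `q - 1` and `q` -/
  Vq' : mesh.FEBasis s b
  Vq : mesh.FEBasis s (b + 1)
  /-- the material tensors of the primal system, on `p`- and `(p - 1)`-forms -/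
  Chat : Mesh.Material metric (a + 1)
  Ehat : Mesh.Material metric a
  /-- the material tensors of the dual system, on `(q - 1)`- and `q`-forms -/
  C : Mesh.Material metric b
  E : Mesh.Material metric (b + 1)
  /-- the splitting of the boundary degrees of freedom of the `(p - 1)`-forms -/
  Γ₁p : Set Vp'.BdryIdx
  Γ₂p : Set Vp'.BdryIdx
  isCompl_p : IsCompl Γ₁p Γ₂p
  /-- the splitting of the boundary degrees of freedom of the `(q - 1)`-forms -/
  Γ₁q : Set Vq'.BdryIdx
  Γ₂q : Set Vq'.BdryIdx
  isCompl_q : IsCompl Γ₁q Γ₂q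

namespace Discretization

variable {a b : ℕ} (S : Discretization a b)

/-- The mass matrices `M^p_Ĉ`, `M^{p-1}_Ê`, `M^{q-1}_C` and `M^q_E`. -/
def MChat : Matrix (Fin S.Vp.N) (Fin S.Vp.N) ℝ := S.Vp.mass S.Chat
def MEhat : Matrix (Fin S.Vp'.N) (Fin S.Vp'.N) ℝ := S.Vp'.mass S.Ehat
def MC : Matrix (Fin S.Vq'.N) (Fin S.Vq'.N) ℝ := S.Vq'.mass S.C
def ME : Matrix (Fin S.Vq.N) (Fin S.Vq.N) ℝ := S.Vq.mass S.E

/-- The derivative matrices `D^{p-1}` and `D^{q-1}`. -/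
def Dp : Matrix (Fin S.Vp.N) (Fin S.Vp'.N) ℝ := S.Vp'.deriv S.metric S.Vp
def Dq : Matrix (Fin S.Vq.N) (Fin S.Vq'.N) ℝ := S.Vq'.deriv S.metric S.Vq

/-- The boundary matrix `Ψ^{q-1}_∂`, with entries `⟨ψ_l^{p-1} | ψ_m^{q-1}⟩_{∂M}`. -/
def Psi : Matrix S.Vp'.BdryIdx S.Vq'.BdryIdx ℝ := Mesh.bdryMatrix rfl S.Vp' S.Vq'

/-- The control matrices `B^{q-1} = (T^{p-1})ᵀ Ψ^{q-1}_∂` and `B^{p-1} = (T^{q-1})ᵀ Ψ^{p-1}_∂`. -/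
def Bq : Matrix (Fin S.Vp'.N) S.Vq'.BdryIdx ℝ := Mesh.control rfl S.Vp' S.Vq'
def Bp : Matrix (Fin S.Vq'.N) S.Vp'.BdryIdx ℝ := Mesh.control (Nat.add_comm b a) S.Vq' S.Vp'

/-- The sign `(-1)^p`. -/
def sgn (_ : Discretization a b) : ℝ := (-1) ^ (a + 1)

/-- The discrete Hamiltonian `½ (ê₁, Ĉ ê₁)_M + ½ (ê₂, Ê ê₂)_M` of the primal system. -/
def hamiltonianPrimal (e₁ : Fin S.Vp.N → ℝ) (e₂ : Fin S.Vp'.N → ℝ) : ℝ :=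
  1 / 2 * S.metric.inner (S.mesh.toL2 (S.Vp.form e₁)) (S.Chat.op (S.mesh.toL2 (S.Vp.form e₁))) +
  1 / 2 * S.metric.inner (S.mesh.toL2 (S.Vp'.form e₂)) (S.Ehat.op (S.mesh.toL2 (S.Vp'.form e₂)))

/-- The discrete Hamiltonian `½ (e₁, C e₁)_M + ½ (e₂, E e₂)_M` of the dual system. -/
def hamiltonianDual (e₁ : Fin S.Vq'.N → ℝ) (e₂ : Fin S.Vq.N → ℝ) : ℝ :=
  1 / 2 * S.metric.inner (S.mesh.toL2 (S.Vq'.form e₁)) (S.C.op (S.mesh.toL2 (S.Vq'.form e₁))) +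
  1 / 2 * S.metric.inner (S.mesh.toL2 (S.Vq.form e₂)) (S.E.op (S.mesh.toL2 (S.Vq.form e₂)))

/-- The index set `I ∪ Γ₁` of the `(p - 1)`-forms: all degrees of freedom outside `Γ₂`. -/
abbrev FreeP := S.Vp'.Rest S.Γ₂p

/-- The index set `I ∪ Γ₂` of the `(q - 1)`-forms: all degrees of freedom outside `Γ₁`. -/
abbrev FreeQ := S.Vq'.Rest S.Γ₁q

/-- The matrix `Â^p_bc` of the midpoint recursion for the primal system. -/
def matrixPrimal (Δt : ℝ) : Matrix (Fin S.Vp.N ⊕ S.FreeP) (Fin S.Vp.N ⊕ S.FreeP) ℝ :=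
  fromBlocks S.MChat (-(1 / 2 * S.sgn * Δt) • S.Dp.submatrix id Subtype.val)
    ((1 / 2 * S.sgn * Δt) • S.Dpᵀ.submatrix Subtype.val id)
    (S.MEhat.submatrix Subtype.val Subtype.val)

/-- The right-hand side `b̂^p_bc` of the midpoint recursion for the primal system. -/
def rhsPrimal (Δt : ℝ) (u₁ : ℕ → S.Γ₁q → ℝ) (u₂ : ℕ → S.Γ₂p → ℝ)
    (e₁ : ℕ → Fin S.Vp.N → ℝ) (e₂ : ℕ → Fin S.Vp'.N → ℝ) (n : ℕ) :
    Fin S.Vp.N ⊕ S.FreeP → ℝ :=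
  fromBlocks S.MChat ((1 / 2 * S.sgn * Δt) • S.Dp.submatrix id Subtype.val)
      (-(1 / 2 * S.sgn * Δt) • S.Dpᵀ.submatrix Subtype.val id)
      (S.MEhat.submatrix Subtype.val Subtype.val) *ᵥ
    Sum.elim (e₁ n) (fun i : S.FreeP => e₂ n i.1) -
  S.sgn • (fromRows 0 (S.MEhat.submatrix Subtype.val (S.Vp'.incl S.Γ₂p)) *ᵥ
    (u₂ (n + 1) - u₂ n)) +
  Δt • (fromBlocks (S.Dp.submatrix id (S.Vp'.incl S.Γ₂p)) 0
      0 (S.sgn • S.Bq.submatrix Subtype.val Subtype.val) *ᵥ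
    Sum.elim (mid u₂ n) (mid u₁ n))

/-- The sequence `(ê_{1,n}, ê_{2,n})` is produced, for `n ≤ Nt`, by the midpoint recursion for the
primal system, with direct assignment of the degrees of freedom on `Γ₂`. -/
structure IsPrimalSolution (Δt : ℝ) (Nt : ℕ) (u₁ : ℕ → S.Γ₁q → ℝ) (u₂ : ℕ → S.Γ₂p → ℝ)
    (e₁ : ℕ → Fin S.Vp.N → ℝ) (e₂ : ℕ → Fin S.Vp'.N → ℝ) : Prop where
  assign : ∀ n ≤ Nt, S.sgn • (S.Vp'.trace.submatrix Subtype.val id : Matrix S.Γ₂p _ ℝ) *ᵥ e₂ n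
    = u₂ n
  step : ∀ n < Nt, S.matrixPrimal Δt *ᵥ
    Sum.elim (e₁ (n + 1)) (fun i : S.FreeP => e₂ (n + 1) i.1) = S.rhsPrimal Δt u₁ u₂ e₁ e₂ n

/-- The matrix `A^q_bc` of the midpoint recursion for the dual system. -/
def matrixDual (Δt : ℝ) : Matrix (S.FreeQ ⊕ Fin S.Vq.N) (S.FreeQ ⊕ Fin S.Vq.N) ℝ :=
  fromBlocks (S.MC.submatrix Subtype.val Subtype.val)
    (-(1 / 2 * Δt) • S.Dqᵀ.submatrix Subtype.val id)
    ((1 / 2 * Δt) • S.Dq.submatrix id Subtype.val) S.ME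

/-- The right-hand side `b^q_bc` of the midpoint recursion for the dual system. -/
def rhsDual (Δt : ℝ) (u₁ : ℕ → S.Γ₁q → ℝ) (u₂ : ℕ → S.Γ₂p → ℝ)
    (e₁ : ℕ → Fin S.Vq'.N → ℝ) (e₂ : ℕ → Fin S.Vq.N → ℝ) (n : ℕ) :
    S.FreeQ ⊕ Fin S.Vq.N → ℝ :=
  fromBlocks (S.MC.submatrix Subtype.val Subtype.val)
      ((1 / 2 * Δt) • S.Dqᵀ.submatrix Subtype.val id)
      (-(1 / 2 * Δt) • S.Dq.submatrix id Subtype.val) S.ME *ᵥ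
    Sum.elim (fun i : S.FreeQ => e₁ n i.1) (e₂ n) -
  fromRows (S.MC.submatrix Subtype.val (S.Vq'.incl S.Γ₁q)) 0 *ᵥ (u₁ (n + 1) - u₁ n) +
  Δt • (fromBlocks 0 ((-1 : ℝ) ^ (a * b) • S.Bp.submatrix Subtype.val Subtype.val)
      (-S.Dq.submatrix id (S.Vq'.incl S.Γ₁q)) 0 *ᵥ
    Sum.elim (mid u₁ n) (mid u₂ n))

/-- The sequence `(e_{1,n}, e_{2,n})` is produced, for `n ≤ Nt`, by the midpoint recursion for the
dual system, with direct assignment of the degrees of freedom on `Γ₁`. -/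
structure IsDualSolution (Δt : ℝ) (Nt : ℕ) (u₁ : ℕ → S.Γ₁q → ℝ) (u₂ : ℕ → S.Γ₂p → ℝ)
    (e₁ : ℕ → Fin S.Vq'.N → ℝ) (e₂ : ℕ → Fin S.Vq.N → ℝ) : Prop where
  assign : ∀ n ≤ Nt, (S.Vq'.trace.submatrix Subtype.val id : Matrix S.Γ₁q _ ℝ) *ᵥ e₁ n = u₁ n
  step : ∀ n < Nt, S.matrixDual Δt *ᵥ
    Sum.elim (fun i : S.FreeQ => e₁ (n + 1) i.1) (e₂ (n + 1)) = S.rhsDual Δt u₁ u₂ e₁ e₂ n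

/-- The midpoint output `ŷ^{p-1}_{2,n+1/2}` on `Γ₁`. -/
def outputP (e₂ : ℕ → Fin S.Vp'.N → ℝ) (n : ℕ) : S.Γ₁p → ℝ :=
  S.sgn • (S.Vp'.trace.submatrix Subtype.val id : Matrix S.Γ₁p _ ℝ) *ᵥ mid e₂ n

/-- The midpoint output `y^{q-1}_{1,n+1/2}` on `Γ₂`. -/
def outputQ (e₁ : ℕ → Fin S.Vq'.N → ℝ) (n : ℕ) : S.Γ₂q → ℝ :=
  (S.Vq'.trace.submatrix Subtype.val id : Matrix S.Γ₂q _ ℝ) *ᵥ mid e₁ n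

/-- The collocated output `ỹ^{p-1}_{n+1/2}` on `Γ₂`. -/
def collocatedP (Δt : ℝ) (e₁ : ℕ → Fin S.Vp.N → ℝ) (e₂ : ℕ → Fin S.Vp'.N → ℝ) (n : ℕ) :
    S.Γ₂p → ℝ :=
  S.sgn • (S.MEhat.submatrix (S.Vp'.incl S.Γ₂p) id *ᵥ (Δt⁻¹ • (e₂ (n + 1) - e₂ n))) +
    S.Dpᵀ.submatrix (S.Vp'.incl S.Γ₂p) id *ᵥ mid e₁ n

/-- The collocated output `ỹ^{q-1}_{n+1/2}` on `Γ₁`. -/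
def collocatedQ (Δt : ℝ) (e₁ : ℕ → Fin S.Vq'.N → ℝ) (e₂ : ℕ → Fin S.Vq.N → ℝ) (n : ℕ) :
    S.Γ₁q → ℝ :=
  S.MC.submatrix (S.Vq'.incl S.Γ₁q) id *ᵥ (Δt⁻¹ • (e₁ (n + 1) - e₁ n)) -
    S.Dqᵀ.submatrix (S.Vq'.incl S.Γ₁q) id *ᵥ mid e₂ n

/-- The blocks `[Ψ^{q-1}]_{Γ₁}^{Γ₁}` and `[Ψ^{q-1}]_{Γ₂}^{Γ₂}`. -/
def Psi₁ : Matrix S.Γ₁p S.Γ₁q ℝ := S.Psi.submatrix Subtype.val Subtype.val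
def Psi₂ : Matrix S.Γ₂p S.Γ₂q ℝ := S.Psi.submatrix Subtype.val Subtype.val

/-- The discrete boundary power of the primal system over one step. -/
def powerPrimal (Δt : ℝ) (u₁ : ℕ → S.Γ₁q → ℝ) (u₂ : ℕ → S.Γ₂p → ℝ)
    (e₁ : ℕ → Fin S.Vp.N → ℝ) (e₂ : ℕ → Fin S.Vp'.N → ℝ) (n : ℕ) : ℝ :=
  mid u₂ n ⬝ᵥ S.collocatedP Δt e₁ e₂ n + S.outputP e₂ n ⬝ᵥ (S.Psi₁ *ᵥ mid u₁ n)

/-- The discrete boundary power of the dual system over one step. -/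
def powerDual (Δt : ℝ) (u₁ : ℕ → S.Γ₁q → ℝ) (u₂ : ℕ → S.Γ₂p → ℝ)
    (e₁ : ℕ → Fin S.Vq'.N → ℝ) (e₂ : ℕ → Fin S.Vq.N → ℝ) (n : ℕ) : ℝ :=
  mid u₁ n ⬝ᵥ S.collocatedQ Δt e₁ e₂ n + mid u₂ n ⬝ᵥ (S.Psi₂ *ᵥ S.outputQ e₁ n)

end Discretization

end DualField

end

noncomputable section

namespace DualField

/-! ### Graded commutativity of the wedge product -/

/-! Each Hamiltonian is a quadratic form in the coefficients whose matrix is a symmetric mass matrix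
`M`, and for such a form the increment over a step is exactly midpoint times `M` times increment
(`dotProduct_mulVec_sub_of_transpose_eq`). It remains to insert the recursion for `M` times
increment.

The recursion is written for the free degrees of freedom, with the prescribed ones moved to the
right-hand side as inputs. Since the inputs are the prescribed coefficients (up to the sign `σ =
(-1)^p` in the primal case), the columns recombine and the recursion expresses `M` times increment
through the full midpoint vectors (`mulVec_sub_fst`, `mulVec_sub_snd`). Only the rows of the
prescribed degrees of freedom are missing. In the energy balance the terms with `D` and `Dᵀ` cancel
on the free rows; what survives on the prescribed rows, together with the mass term there, is input
times collocated output. This uses only that the two blocks are transposes of each other, not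
Stokes' theorem.

The remaining term contains `B = Tᵀ Ψ`, whose interior rows vanish, so that a block of `Ψ` is left
(`dotProduct_trace_transpose_mul`). In the dual system the block comes from `Ψ^{p-1}`; graded
commutativity of the wedge product turns it into the transpose of a block of `Ψ^{q-1}`, and the sign
`(-1)^{(p-1)(q-1)}` in the recursion compensates for the swap (`smul_bdryMatrix`). -/

theorem finRotate_pow_apply_val {m : ℕ} (j : ℕ) (i : Fin m) :
    (((finRotate m) ^ j) i : ℕ) = (i + j) % m := by
  obtain _ | m := m
  · exact i.elim0
  induction j with
  | zero => simp [Nat.mod_eq_of_lt i.2]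
  | succ j ih =>
    rw [pow_succ', Equiv.Perm.mul_apply, finRotate_apply, Fin.val_add, ih, Fin.val_one',
      ← Nat.add_mod, add_assoc]

/-- The permutation of `Fin m` that exchanges the first `k` with the last `l` indices. -/
def blockSwap {k l m : ℕ} (h : k + l = m) (h' : l + k = m) : Equiv.Perm (Fin m) :=
  ((finSumFinEquiv.trans (finCongr h)).symm.trans (Equiv.sumComm _ _)).trans
    (finSumFinEquiv.trans (finCongr h'))

theorem blockSwap_eq_finRotate_pow {k l m : ℕ} (h : k + l = m) (h' : l + k = m) :
    blockSwap h h' = finRotate m ^ l := by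
  subst h
  ext i
  rw [finRotate_pow_apply_val]
  obtain ⟨x, rfl⟩ := finSumFinEquiv.surjective i
  rcases x with x | x
  · have : l + (x : ℕ) < k + l := by omega
    simp [blockSwap, add_comm (x : ℕ), Nat.mod_eq_of_lt this]
  · have : (x : ℕ) < k + l := by omega
    have h2 : k + (x : ℕ) + l = x + (k + l) := by omega
    simp [blockSwap, h2, Nat.mod_eq_of_lt this]

/-- The swap is the `l`-th power of a cycle of length `k + l`, so the exponent is `(k + l - 1) l = k
l + l (l - 1)`, and `l (l - 1)` is even. -/
theorem sign_blockSwap {k l m : ℕ} (h : k + l = m) (h' : l + k = m) :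
    Equiv.Perm.sign (blockSwap h h') = (-1) ^ (k * l) := by
  subst h
  rw [blockSwap_eq_finRotate_pow, map_pow, sign_finRotate, ← pow_mul]
  obtain _ | l := l
  · simp
  have h2 : (k + (l + 1) - 1) * (l + 1) = k * (l + 1) + l * (l + 1) := by
    rw [← add_assoc, Nat.add_sub_cancel, add_mul]
  rw [h2, pow_add, (Nat.even_mul_succ_self l).neg_one_pow, mul_one]

/-- The wedge product sums over cosets of permutations (shuffles). Multiplying by `k! l!`, the order
of the subgroup, gives a sum over all permutations, which is easier to reindex. -/
theorem factorial_smul_wedge_apply {n k l m : ℕ} (h : k + l = m) (α : Alt n k) (β : Alt n l)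
    (v : Fin m → Eucl n) :
    ((k.factorial * l.factorial : ℕ) : ℝ) * wedge h α β v =
      ∑ σ : Equiv.Perm (Fin k ⊕ Fin l), ((Equiv.Perm.sign σ : ℤ) : ℝ) *
        (α (fun i => v (finCongr h (finSumFinEquiv (σ (Sum.inl i))))) *
          β (fun i => v (finCongr h (finSumFinEquiv (σ (Sum.inr i)))))) := by
  have key := congrArg (fun F => LinearMap.mul' ℝ ℝ
    (F (fun i => v (finCongr h (finSumFinEquiv i)))))
    (MultilinearMap.domCoprod_alternization_eq α.toAlternatingMap β.toAlternatingMap)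
  simp only [MultilinearMap.alternatization_apply, map_sum, Fintype.card_fin] at key
  rw [← nsmul_eq_mul]
  have h1 : (k.factorial * l.factorial) • wedge h α β v = LinearMap.mul' ℝ ℝ
      (((k.factorial * l.factorial) • α.toAlternatingMap.domCoprod β.toAlternatingMap)
        (fun i => v (finCongr h (finSumFinEquiv i)))) := by
    rw [AlternatingMap.smul_apply, map_nsmul]
    rfl
  rw [h1, ← key]
  refine Finset.sum_congr rfl fun σ _ => ?_
  rw [Units.smul_def, map_zsmul, zsmul_eq_mul]
  rfl

theorem wedge_comm {n k l m : ℕ} (h : k + l = m) (h' : l + k = m) (α : Alt n k) (β : Alt n l)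
    (v : Fin m → Eucl n) :
    wedge h' β α v = (-1) ^ (k * l) * wedge h α β v := by
  have hne : ((k.factorial * l.factorial : ℕ) : ℝ) ≠ 0 := by positivity
  have hsign : wedge h α β (v ∘ blockSwap h h') = (-1) ^ (k * l) * wedge h α β v := by
    rw [AlternatingMap.map_perm, sign_blockSwap, Units.smul_def, zsmul_eq_mul]
    simp
  rw [← hsign]
  refine mul_left_cancel₀ hne ?_
  rw [factorial_smul_wedge_apply h α β, mul_comm k.factorial, factorial_smul_wedge_apply h' β α]
  -- Conjugation by the exchange of the two summands preserves signs and matches the terms of the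
  -- two sums.
  refine (Fintype.sum_equiv (Equiv.sumComm (Fin k) (Fin l)).permCongr _ _ fun σ => ?_).symm
  rw [Equiv.Perm.sign_permCongr, mul_comm (α _)]
  simp [blockSwap, Equiv.permCongr_apply]

namespace Mesh

theorem bdryDual_comm {m s k l : ℕ} {𝓣 : Mesh (m + 1)} (h : k + l = m) (h' : l + k = m)
    (u : 𝓣.feSpace s k) (v : 𝓣.feSpace s l) :
    bdryDual h' v u = (-1) ^ (k * l) * bdryDual h u v := by
  unfold bdryDual bdryIntegral simplexIntegral
  rw [Finset.mul_sum]
  refine Finset.sum_congr rfl fun T _ => ?_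
  rw [Finset.mul_sum]
  refine Finset.sum_congr rfl fun w _ => ?_
  split_ifs
  · rw [mul_left_comm, ← integral_const_mul ((-1 : ℝ) ^ (k * l))]
    simp only [wedge_comm h h']
  · rw [mul_zero]

/-! ### Bilinearity of the inner product of forms -/

variable {n : ℕ} {𝓣 : Mesh n}

theorem memLp_apply {k : ℕ} {μ : Measure (Eucl n)} {α : Form n k}
    (hα : MemLp α 2 μ) (v : Fin k → Eucl n) : MemLp (fun x => α x v) 2 μ :=
  (ContinuousAlternatingMap.apply ℝ (Eucl n) ℝ v).comp_memLp' hα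

namespace Metric

variable (g : 𝓣.Metric) {k : ℕ}

theorem continuousOn_inv (i j : Fin n) :
    ContinuousOn (fun x => (g.toMatrix x)⁻¹ i j) 𝓣.domain := by
  have hA : ContinuousOn g.toMatrix 𝓣.domain :=
    continuousOn_pi.2 fun i => continuousOn_pi.2 fun j => g.continuousOn i j
  have h : ContinuousOn (fun x => (g.toMatrix x)⁻¹) 𝓣.domain := by
    intro x hx
    refine ContinuousAt.comp_continuousWithinAt (g := Inv.inv) ?_ (hA x hx)
    exact continuousAt_matrix_inv _
      -- Inversion of matrices is continuous where the determinant is nonzero, which positive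
      -- definiteness ensures on the domain.
      (by simpa using continuousAt_inv₀ (g.posDef x hx).det_pos.ne')
  exact continuousOn_pi.1 (continuousOn_pi.1 h i) j

theorem continuousOn_sqrt_det : ContinuousOn (fun x => √(g.toMatrix x).det) 𝓣.domain := by
  have hA : ContinuousOn g.toMatrix 𝓣.domain :=
    continuousOn_pi.2 fun i => continuousOn_pi.2 fun j => g.continuousOn i j
  exact (continuous_id.matrix_det.comp_continuousOn hA).sqrt

/-- Products of two `L²` coefficients are integrable, and the metric factors are continuous on the
compact domain. -/
theorem integrable_pointwise {α β : Form n k} (hα : MemLp α 2 (volume.restrict 𝓣.domain))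
    (hβ : MemLp β 2 (volume.restrict 𝓣.domain)) :
    Integrable (fun x => g.pointwise x (α x) (β x) * √(g.toMatrix x).det)
      (volume.restrict 𝓣.domain) := by
  have h : ∀ I J : Fin k → Fin n, Integrable (fun x => (∏ r, (g.toMatrix x)⁻¹ (I r) (J r)) *
      α x (fun r => EuclideanSpace.single (I r) 1) * β x (fun r => EuclideanSpace.single (J r) 1))
      (volume.restrict 𝓣.domain) := fun I J => by
    simp only [mul_assoc]
    exact IntegrableOn.continuousOn_mul
      (continuousOn_finsetProd _ fun r _ => g.continuousOn_inv (I r) (J r))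
      ((memLp_apply hα _).integrable_mul (memLp_apply hβ _)) 𝓣.isCompact_domain
  exact IntegrableOn.mul_continuousOn
    ((integrable_finsetSum _ fun I _ => integrable_finsetSum _ fun J _ => h I J).const_mul _)
    g.continuousOn_sqrt_det 𝓣.isCompact_domain

theorem pointwise_comm {x : Eucl n} (hx : x ∈ 𝓣.domain) (α β : Alt n k) :
    g.pointwise x α β = g.pointwise x β α := by
  have hs : ∀ i j, (g.toMatrix x)⁻¹ i j = (g.toMatrix x)⁻¹ j i := fun i j => by
    simpa using (g.posDef x hx).isHermitian.inv.apply j i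
  unfold pointwise
  rw [Finset.sum_comm]
  simp only [fun I J : Fin k → Fin n => Finset.prod_congr rfl
    fun (r : Fin k) (_ : r ∈ Finset.univ) => hs (I r) (J r), mul_right_comm]

theorem pointwise_add_left (x : Eucl n) (α α' β : Alt n k) :
    g.pointwise x (α + α') β = g.pointwise x α β + g.pointwise x α' β := by
  simp only [pointwise, ContinuousAlternatingMap.add_apply, mul_add, add_mul,
    Finset.sum_add_distrib]

theorem pointwise_smul_left (x : Eucl n) (c : ℝ) (α β : Alt n k) :
    g.pointwise x (c • α) β = c * g.pointwise x α β := by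
  simp only [pointwise, ContinuousAlternatingMap.smul_apply, smul_eq_mul, Finset.mul_sum]
  refine Finset.sum_congr rfl fun I _ => Finset.sum_congr rfl fun J _ => ?_
  ring

theorem inner_comm (α β : Form n k) : g.inner α β = g.inner β α :=
  setIntegral_congr_fun 𝓣.isCompact_domain.measurableSet fun x hx => by
    simp only [g.pointwise_comm hx (α x)]

theorem inner_congr_left {α α' : Form n k} (h : α =ᵐ[volume.restrict 𝓣.domain] α')
    (β : Form n k) : g.inner α β = g.inner α' β :=
  integral_congr_ae <| by filter_upwards [h] with x hx; rw [hx]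

theorem inner_add_left {α α' β : Form n k} (hα : MemLp α 2 (volume.restrict 𝓣.domain))
    (hα' : MemLp α' 2 (volume.restrict 𝓣.domain)) (hβ : MemLp β 2 (volume.restrict 𝓣.domain)) :
    g.inner (α + α') β = g.inner α β + g.inner α' β := by
  unfold inner
  rw [← integral_add (g.integrable_pointwise hα hβ) (g.integrable_pointwise hα' hβ)]
  simp only [Pi.add_apply, pointwise_add_left, add_mul]

theorem inner_smul_left (c : ℝ) (α β : Form n k) : g.inner (c • α) β = c * g.inner α β := by
  unfold inner
  rw [← integral_const_mul]
  simp only [Pi.smul_apply, pointwise_smul_left, mul_assoc]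

/-- The inner product of `L² Ω^k(M)` as a bilinear form. -/
def bilin (g : 𝓣.Metric) (k : ℕ) : 𝓣.L2 k →ₗ[ℝ] 𝓣.L2 k →ₗ[ℝ] ℝ :=
  have hadd : ∀ α α' β : 𝓣.L2 k, g.inner ↑(α + α') β = g.inner α β + g.inner α' β :=
    fun α α' β => by
      rw [g.inner_congr_left (Lp.coeFn_add α α'),
        g.inner_add_left (Lp.memLp α) (Lp.memLp α') (Lp.memLp β)]
  have hsmul : ∀ (c : ℝ) (α β : 𝓣.L2 k), g.inner ↑(c • α) β = c • g.inner α β :=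
    fun c α β => by
      rw [g.inner_congr_left (Lp.coeFn_smul c α), g.inner_smul_left, smul_eq_mul]
  LinearMap.mk₂ ℝ (fun α β => g.inner α β) hadd hsmul
    -- Linearity in the second argument follows from the first by symmetry.
    (fun α β β' => by rw [g.inner_comm, hadd, g.inner_comm β, g.inner_comm β'])
    (fun c α β => by rw [g.inner_comm, hsmul, g.inner_comm β])

theorem bilin_apply (α β : 𝓣.L2 k) : g.bilin k α β = g.inner α β := rfl

end Metric

variable (𝓣) in
/-- The inclusion of the discrete forms into `L² Ω^k(M)` as a linear map. -/
def toL2Linear (s k : ℕ) : 𝓣.feSpace s k →ₗ[ℝ] 𝓣.L2 k where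
  toFun := 𝓣.toL2
  map_add' u w := by
    unfold toL2
    rw [← MemLp.toLp_add]
    congr 1
    funext x
    exact (Finset.sum_congr rfl fun T _ => congrFun (Set.indicator_add' _ (u.1 T) (w.1 T)) x).trans
      Finset.sum_add_distrib
  map_smul' c u := by
    unfold toL2
    rw [RingHom.id_apply, ← MemLp.toLp_const_smul]
    congr 1
    funext x
    exact (Finset.sum_congr rfl fun T _ => Set.indicator_const_smul_apply _ c (u.1 T) x).trans
      Finset.smul_sum.symm

/-! ### Mass matrices and the splitting of the degrees of freedom -/

namespace FEBasis

variable {s k : ℕ} (V : 𝓣.FEBasis s k) {g : 𝓣.Metric}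

theorem inner_form (C : Material g k) (e : Fin V.N → ℝ) :
    g.inner (𝓣.toL2 (V.form e)) (C.op (𝓣.toL2 (V.form e))) = e ⬝ᵥ (V.mass C *ᵥ e) := by
  have h : 𝓣.toL2 (V.form e) = ∑ i, e i • 𝓣.toL2 (V.φ i) := by
    have := map_sum (𝓣.toL2Linear s k) (fun i => e i • V.φ i) Finset.univ
    simp only [map_smul] at this
    exact this
  rw [← Metric.bilin_apply, h]
  simp only [map_sum, map_smul, LinearMap.sum_apply, LinearMap.smul_apply, smul_eq_mul,
    dotProduct, mulVec, mass, ← Metric.bilin_apply, Finset.mul_sum]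
  exact Finset.sum_comm.trans
    (Finset.sum_congr rfl fun i _ => Finset.sum_congr rfl fun j _ => by ring)

theorem mass_transpose (C : Material g k) : (V.mass C)ᵀ = V.mass C := by
  ext i j
  rw [transpose_apply]
  unfold mass
  rw [C.symm, g.inner_comm]

theorem sum_rest_add_sum_incl {E : Type*} [AddCommMonoid E] (Γ : Set V.BdryIdx) (f : Fin V.N → E) :
    ∑ i : V.Rest Γ, f i.1 + ∑ l : Γ, f (V.incl Γ l) = ∑ i, f i := by
  rw [← Fintype.sum_subtype_add_sum_subtype
    (fun i => ∀ h : V.IsBdry i, (⟨i, h⟩ : V.BdryIdx) ∉ Γ) f]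
  congr 1
  refine Fintype.sum_equiv
    -- An index that is not in `Rest Γ` is a boundary index in `Γ`; the negated condition supplies
    -- both proofs.
    ⟨fun l => ⟨l.1.1, fun h => h l.1.2 l.2⟩, 
      fun i => ⟨⟨i.1, (not_forall.1 i.2).choose⟩, not_not.1 (not_forall.1 i.2).choose_spec⟩,
      fun _ => rfl, fun _ => rfl⟩
    _ _ fun _ => rfl

theorem mulVec_rest_add_incl {R : Type*} (Γ : Set V.BdryIdx) (A : Matrix R (Fin V.N) ℝ)
    (x : Fin V.N → ℝ) :
    A.submatrix id Subtype.val *ᵥ (fun i : V.Rest Γ => x i.1) +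
      A.submatrix id (V.incl Γ) *ᵥ (fun l => x (V.incl Γ l)) = A *ᵥ x := by
  ext i
  exact V.sum_rest_add_sum_incl Γ fun j => A i j * x j

theorem dotProduct_rest_add_incl (Γ : Set V.BdryIdx) (x y : Fin V.N → ℝ) :
    (fun i : V.Rest Γ => x i.1) ⬝ᵥ (fun i => y i.1) +
      (fun l => x (V.incl Γ l)) ⬝ᵥ (fun l => y (V.incl Γ l)) = x ⬝ᵥ y :=
  V.sum_rest_add_sum_incl Γ fun j => x j * y j

theorem trace_mulVec (Γ : Set V.BdryIdx) (x : Fin V.N → ℝ) :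
    (V.trace.submatrix Subtype.val id : Matrix Γ _ ℝ) *ᵥ x = fun l => x (V.incl Γ l) := by
  ext l
  simp [mulVec, dotProduct, trace, incl]

/-- The rows of a boundary control matrix at the degrees of freedom outside `Γ'` reduce to the
rows of the boundary matrix in the complement of `Γ'`. -/
theorem dotProduct_trace_transpose_mul {R : Type*} [Fintype R] {Γ Γ' : Set V.BdryIdx}
    (h : IsCompl Γ Γ') (A : Matrix V.BdryIdx R ℝ) (x : Fin V.N → ℝ) (y : R → ℝ) :
    (fun i : V.Rest Γ' => x i.1) ⬝ᵥ ((V.traceᵀ * A).submatrix Subtype.val id *ᵥ y) =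
      (fun l => x (V.incl Γ l)) ⬝ᵥ (A.submatrix Subtype.val id *ᵥ y) := by
  set z : Fin V.N → ℝ := (V.traceᵀ * A) *ᵥ y with hz
  have hz' : ∀ i, z i = ∑ l : V.BdryIdx, V.trace l i * (A *ᵥ y) l := fun i => by
    rw [hz, ← mulVec_mulVec]
    rfl
  have hB : ∀ l : V.BdryIdx, z l.1 = (A *ᵥ y) l := fun l => by
    rw [hz', Finset.sum_eq_single l]
    · rw [trace, if_pos rfl, one_mul]
    · intro l' _ hl
      rw [trace, if_neg (fun h => hl (Subtype.ext h)), zero_mul]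
    · exact fun h => absurd (Finset.mem_univ l) h
  have hI : ∀ i, ¬ V.IsBdry i → z i = 0 := fun i hi => by
    rw [hz']
    refine Finset.sum_eq_zero fun l _ => ?_
    rw [trace, if_neg (fun hl : l.1 = i => hi (hl ▸ l.2)), zero_mul]
  change ∑ i : V.Rest Γ', x i.1 * z i.1 = ∑ l : Γ, x l.1.1 * (A *ᵥ y) l.1
  have h1 : ∑ l : Γ, x l.1.1 * (A *ᵥ y) l.1 = ∑ l : Γ, x (V.incl Γ l) * z (V.incl Γ l) :=
    Finset.sum_congr rfl fun l _ => by rw [← hB]; rfl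
  have hc : ∀ l : V.BdryIdx, l ∈ Γ ↔ l ∉ Γ' := fun l => by
    rw [← h.symm.compl_eq]; rfl
  rw [h1]
  -- `Γ` embeds into the indices outside `Γ'`. An index missed by the embedding must be interior,
  -- because a boundary index outside `Γ'` lies in `Γ`; there `z` vanishes.
  refine (Finset.sum_of_injOn
    (fun l : Γ => (⟨V.incl Γ l, fun _ => (hc l.1).1 l.2⟩ : V.Rest Γ')) ?_ ?_ ?_ ?_).symm
  · intro l _ l' _ hl
    exact Subtype.ext (Subtype.ext (congrArg (fun i : V.Rest Γ' => i.1) hl))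
  · exact fun _ _ => Finset.mem_coe.2 (Finset.mem_univ _)
  · intro i _ hi
    rw [hI i.1, mul_zero]
    intro hb
    exact hi ⟨⟨⟨i.1, hb⟩, (hc _).2 (i.2 hb)⟩, Finset.mem_coe.2 (Finset.mem_univ _), rfl⟩
  · exact fun _ _ => rfl

end FEBasis
end Mesh
/-! ### The energy balance -/

/-- A difference of squares: the cross terms cancel by symmetry of `A`. This is why the midpoint
rule has no energy error. -/
theorem dotProduct_mulVec_sub_of_transpose_eq {ι : Type*} [Fintype ι] {A : Matrix ι ι ℝ}
    (hA : Aᵀ = A) (x : ℕ → ι → ℝ) (n : ℕ) :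
    1 / 2 * (x (n + 1) ⬝ᵥ (A *ᵥ x (n + 1))) - 1 / 2 * (x n ⬝ᵥ (A *ᵥ x n)) =
      mid x n ⬝ᵥ (A *ᵥ (x (n + 1) - x n)) := by
  have h : x n ⬝ᵥ (A *ᵥ x (n + 1)) = x (n + 1) ⬝ᵥ (A *ᵥ x n) := by
    rw [dotProduct_mulVec, ← mulVec_transpose, hA, dotProduct_comm]
  simp only [mid, mulVec_sub, dotProduct_sub, smul_dotProduct, add_dotProduct, smul_eq_mul, h]
  ring

namespace Discretization

variable {a b : ℕ} (S : Discretization a b)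

theorem sgn_mul_sgn : S.sgn * S.sgn = 1 := by
  rw [sgn, ← mul_pow, neg_one_mul, neg_neg, one_pow]

variable {S} {Δt : ℝ} {Nt : ℕ} {u₁ : ℕ → S.Γ₁q → ℝ} {u₂ : ℕ → S.Γ₂p → ℝ}

theorem hamiltonianPrimal_sub (e₁ : ℕ → Fin S.Vp.N → ℝ) (e₂ : ℕ → Fin S.Vp'.N → ℝ) (n : ℕ) :
    S.hamiltonianPrimal (e₁ (n + 1)) (e₂ (n + 1)) - S.hamiltonianPrimal (e₁ n) (e₂ n) =
      mid e₁ n ⬝ᵥ (S.MChat *ᵥ (e₁ (n + 1) - e₁ n)) +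
        mid e₂ n ⬝ᵥ (S.MEhat *ᵥ (e₂ (n + 1) - e₂ n)) := by
  rw [MChat, MEhat, ← dotProduct_mulVec_sub_of_transpose_eq (S.Vp.mass_transpose S.Chat),
    ← dotProduct_mulVec_sub_of_transpose_eq (S.Vp'.mass_transpose S.Ehat)]
  simp only [hamiltonianPrimal, Mesh.FEBasis.inner_form]
  ring

theorem hamiltonianDual_sub (e₁ : ℕ → Fin S.Vq'.N → ℝ) (e₂ : ℕ → Fin S.Vq.N → ℝ) (n : ℕ) :
    S.hamiltonianDual (e₁ (n + 1)) (e₂ (n + 1)) - S.hamiltonianDual (e₁ n) (e₂ n) =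
      mid e₁ n ⬝ᵥ (S.MC *ᵥ (e₁ (n + 1) - e₁ n)) +
        mid e₂ n ⬝ᵥ (S.ME *ᵥ (e₂ (n + 1) - e₂ n)) := by
  rw [MC, ME, ← dotProduct_mulVec_sub_of_transpose_eq (S.Vq'.mass_transpose S.C),
    ← dotProduct_mulVec_sub_of_transpose_eq (S.Vq.mass_transpose S.E)]
  simp only [hamiltonianDual, Mesh.FEBasis.inner_form]
  ring

/-! ### The primal system -/

namespace IsPrimalSolution

variable {e₁ : ℕ → Fin S.Vp.N → ℝ} {e₂ : ℕ → Fin S.Vp'.N → ℝ}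

theorem assign_apply (h : S.IsPrimalSolution Δt Nt u₁ u₂ e₁ e₂) {n : ℕ} (hn : n ≤ Nt) :
    u₂ n = S.sgn • fun l => e₂ n (S.Vp'.incl S.Γ₂p l) := by
  rw [← h.assign n hn, Mesh.FEBasis.trace_mulVec]

/-- The input term supplies the `Γ₂` columns of `D`; the sign in the assignment gives them the same
factor `Δt σ` as the free columns. -/
theorem mulVec_sub_fst (h : S.IsPrimalSolution Δt Nt u₁ u₂ e₁ e₂) {n : ℕ} (hn : n < Nt) :
    S.MChat *ᵥ (e₁ (n + 1) - e₁ n) = (Δt * S.sgn) • S.Dp *ᵥ mid e₂ n := by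
  ext i
  have hstep := congrFun (h.step n hn) (Sum.inl i)
  have h0 := congrFun (S.Vp'.mulVec_rest_add_incl S.Γ₂p S.Dp (e₂ n)) i
  have h1 := congrFun (S.Vp'.mulVec_rest_add_incl S.Γ₂p S.Dp (e₂ (n + 1))) i
  simp only [matrixPrimal, rhsPrimal, fromBlocks_mulVec, fromRows_mulVec, mid,
    h.assign_apply (Nat.succ_le_of_lt hn : n + 1 ≤ Nt), h.assign_apply hn.le, Pi.add_apply,
    Pi.sub_apply, Pi.smul_apply,
    Sum.elim_inl, Sum.elim_comp_inl, Sum.elim_comp_inr, smul_mulVec, mulVec_smul, mulVec_add,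
    zero_mulVec, Pi.zero_apply, smul_eq_mul] at hstep h0 h1
  simp only [mid, mulVec_sub, mulVec_smul, mulVec_add, Pi.add_apply, Pi.sub_apply,
    Pi.smul_apply, smul_eq_mul]
  linear_combination hstep + (1 / 2 * Δt * S.sgn) * h0 + (1 / 2 * Δt * S.sgn) * h1

theorem mulVec_sub_snd (h : S.IsPrimalSolution Δt Nt u₁ u₂ e₁ e₂) {n : ℕ} (hn : n < Nt) :
    (fun i : S.FreeP => (S.MEhat *ᵥ (e₂ (n + 1) - e₂ n)) i.1) =
      (Δt * S.sgn) • (S.Bq.submatrix Subtype.val Subtype.val *ᵥ mid u₁ n -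
        fun i : S.FreeP => (S.Dpᵀ *ᵥ mid e₁ n) i.1) := by
  ext i
  have hstep := congrFun (h.step n hn) (Sum.inr i)
  have h0 := congrFun (S.Vp'.mulVec_rest_add_incl S.Γ₂p S.MEhat (e₂ n)) i.1
  have h1 := congrFun (S.Vp'.mulVec_rest_add_incl S.Γ₂p S.MEhat (e₂ (n + 1))) i.1
  simp only [matrixPrimal, rhsPrimal, fromBlocks_mulVec, fromRows_mulVec,
    h.assign_apply (Nat.succ_le_of_lt hn : n + 1 ≤ Nt), h.assign_apply hn.le, ← smul_sub,
    Pi.add_apply, Pi.sub_apply, Pi.smul_apply,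
    Sum.elim_inr, Sum.elim_comp_inl, Sum.elim_comp_inr, smul_mulVec, mulVec_smul, mulVec_sub,
    zero_mulVec, Pi.zero_apply, smul_eq_mul] at hstep h0 h1
  simp only [mid, mulVec_sub, mulVec_smul, mulVec_add, Pi.add_apply, Pi.sub_apply,
    Pi.smul_apply, smul_eq_mul] at hstep ⊢
  simp only [mulVec, dotProduct, submatrix_apply, id] at hstep h0 h1 ⊢
  -- In the `Γ₂` columns of the mass matrix the sign of the recursion meets the sign of the
  -- assignment, so `σ² = 1` is needed there.
  linear_combination hstep + h0 - h1 +
    (∑ x, S.MEhat i.1 (S.Vp'.incl S.Γ₂p x) * e₂ n (S.Vp'.incl S.Γ₂p x) -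
      ∑ x, S.MEhat i.1 (S.Vp'.incl S.Γ₂p x) * e₂ (n + 1) (S.Vp'.incl S.Γ₂p x)) * S.sgn_mul_sgn

theorem energy_balance (h : S.IsPrimalSolution Δt Nt u₁ u₂ e₁ e₂) (hΔt : Δt ≠ 0) {n : ℕ}
    (hn : n < Nt) :
    (S.hamiltonianPrimal (e₁ (n + 1)) (e₂ (n + 1)) - S.hamiltonianPrimal (e₁ n) (e₂ n)) / Δt =
      S.powerPrimal Δt u₁ u₂ e₁ e₂ n := by
  have hu : mid u₂ n = S.sgn • fun l => mid e₂ n (S.Vp'.incl S.Γ₂p l) := by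
    rw [mid, h.assign_apply (Nat.succ_le_of_lt hn : n + 1 ≤ Nt), h.assign_apply hn.le]
    ext l
    simp only [mid, Pi.smul_apply, Pi.add_apply, smul_eq_mul]
    ring
  have hM := S.Vp'.dotProduct_rest_add_incl S.Γ₂p (mid e₂ n) (S.MEhat *ᵥ (e₂ (n + 1) - e₂ n))
  have hD := S.Vp'.dotProduct_rest_add_incl S.Γ₂p (mid e₂ n) (S.Dpᵀ *ᵥ mid e₁ n)
  -- The free rows of `B` reduce to the rows in `Γ₁`; the columns are restricted to `Γ₁` beforehand.
  have hB := Mesh.FEBasis.dotProduct_trace_transpose_mul S.Vp' S.isCompl_p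
    (S.Psi.submatrix id Subtype.val) (mid e₂ n) (mid u₁ n)
  have hT : mid e₂ n ⬝ᵥ (S.Dpᵀ *ᵥ mid e₁ n) = mid e₁ n ⬝ᵥ (S.Dp *ᵥ mid e₂ n) := by
    rw [dotProduct_mulVec, vecMul_transpose, dotProduct_comm]
  have hB' : (fun i : S.FreeP => mid e₂ n i.1) ⬝ᵥ
      (S.Bq.submatrix Subtype.val Subtype.val *ᵥ mid u₁ n) =
      (fun l => mid e₂ n (S.Vp'.incl S.Γ₁p l)) ⬝ᵥ (S.Psi₁ *ᵥ mid u₁ n) := hB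
  have hc : (fun l => mid e₂ n (S.Vp'.incl S.Γ₂p l)) ⬝ᵥ S.collocatedP Δt e₁ e₂ n =
      S.sgn * Δt⁻¹ * ((fun l => mid e₂ n (S.Vp'.incl S.Γ₂p l)) ⬝ᵥ
        (fun l => (S.MEhat *ᵥ (e₂ (n + 1) - e₂ n)) (S.Vp'.incl S.Γ₂p l))) +
      (fun l => mid e₂ n (S.Vp'.incl S.Γ₂p l)) ⬝ᵥ
        (fun l => (S.Dpᵀ *ᵥ mid e₁ n) (S.Vp'.incl S.Γ₂p l)) := by
    rw [collocatedP, mulVec_smul, dotProduct_add, dotProduct_smul, dotProduct_smul, smul_eq_mul,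
      smul_eq_mul, ← mul_assoc]
    rfl
  rw [hamiltonianPrimal_sub, ← hM, h.mulVec_sub_fst hn, h.mulVec_sub_snd hn, powerPrimal, outputP,
    hu, smul_dotProduct, hc, Mesh.FEBasis.trace_mulVec, smul_dotProduct,
    dotProduct_smul, dotProduct_smul, dotProduct_sub, hB', ← hT, ← hD, div_eq_iff hΔt]
  simp only [smul_eq_mul]
  -- Only the mass term on `Γ₂` is left to compare; it carries the factor `Δt Δt⁻¹ σ²` on one side
  -- and `1` on the other.
  linear_combination -((fun l => mid e₂ n (S.Vp'.incl S.Γ₂p l)) ⬝ᵥ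
    (fun l => (S.MEhat *ᵥ (e₂ (n + 1) - e₂ n)) (S.Vp'.incl S.Γ₂p l))) *
    (Δt * Δt⁻¹ * S.sgn_mul_sgn + mul_inv_cancel₀ hΔt)

end IsPrimalSolution

/-- The sign of the control term in the dual system turns `Ψ^{p-1}` into `(Ψ^{q-1})ᵀ`. -/
theorem smul_bdryMatrix (S : Discretization a b) :
    (-1 : ℝ) ^ (a * b) • Mesh.bdryMatrix (Nat.add_comm b a) S.Vq' S.Vp' = S.Psiᵀ := by
  ext i j
  have h : Mesh.bdryMatrix (Nat.add_comm b a) S.Vq' S.Vp' i j = (-1) ^ (a * b) * S.Psi j i :=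
    Mesh.bdryDual_comm rfl _ _ _
  rw [Matrix.smul_apply, h, smul_eq_mul, ← mul_assoc, ← mul_pow, neg_one_mul, neg_neg, one_pow,
    one_mul,
    transpose_apply]

/-! ### The dual system -/

namespace IsDualSolution

variable {e₁ : ℕ → Fin S.Vq'.N → ℝ} {e₂ : ℕ → Fin S.Vq.N → ℝ}

theorem assign_apply (h : S.IsDualSolution Δt Nt u₁ u₂ e₁ e₂) {n : ℕ} (hn : n ≤ Nt) :
    u₁ n = fun l => e₁ n (S.Vq'.incl S.Γ₁q l) := by
  rw [← h.assign n hn, Mesh.FEBasis.trace_mulVec]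

theorem mulVec_sub_snd (h : S.IsDualSolution Δt Nt u₁ u₂ e₁ e₂) {n : ℕ} (hn : n < Nt) :
    S.ME *ᵥ (e₂ (n + 1) - e₂ n) = -Δt • S.Dq *ᵥ mid e₁ n := by
  ext i
  have hstep := congrFun (h.step n hn) (Sum.inr i)
  have h0 := congrFun (S.Vq'.mulVec_rest_add_incl S.Γ₁q S.Dq (e₁ n)) i
  have h1 := congrFun (S.Vq'.mulVec_rest_add_incl S.Γ₁q S.Dq (e₁ (n + 1))) i
  simp only [matrixDual, rhsDual, fromBlocks_mulVec, fromRows_mulVec, mid,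
    h.assign_apply (Nat.succ_le_of_lt hn : n + 1 ≤ Nt), h.assign_apply hn.le, Pi.add_apply,
    Pi.sub_apply, Pi.smul_apply,
    Sum.elim_inr, Sum.elim_comp_inl, Sum.elim_comp_inr, smul_mulVec, mulVec_smul, mulVec_add,
    zero_mulVec, neg_mulVec, Pi.neg_apply, Pi.zero_apply, smul_eq_mul] at hstep h0 h1
  simp only [mid, mulVec_sub, mulVec_smul, mulVec_add, Pi.add_apply, Pi.sub_apply,
    Pi.smul_apply, smul_eq_mul]
  linear_combination hstep - (1 / 2 * Δt) * h0 - (1 / 2 * Δt) * h1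

/-- The input increment completes the columns of the mass matrix. The rows in `Γ₁` are not part of
the recursion, so the identity holds on the free rows only. -/
theorem mulVec_sub_fst (h : S.IsDualSolution Δt Nt u₁ u₂ e₁ e₂) {n : ℕ} (hn : n < Nt) :
    (fun i : S.FreeQ => (S.MC *ᵥ (e₁ (n + 1) - e₁ n)) i.1) =
      Δt • ((-1 : ℝ) ^ (a * b) • S.Bp.submatrix Subtype.val Subtype.val *ᵥ mid u₂ n +
        fun i : S.FreeQ => (S.Dqᵀ *ᵥ mid e₂ n) i.1) := by
  ext i
  have hstep := congrFun (h.step n hn) (Sum.inl i)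
  have h0 := congrFun (S.Vq'.mulVec_rest_add_incl S.Γ₁q S.MC (e₁ n)) i.1
  have h1 := congrFun (S.Vq'.mulVec_rest_add_incl S.Γ₁q S.MC (e₁ (n + 1))) i.1
  simp only [matrixDual, rhsDual, fromBlocks_mulVec, fromRows_mulVec,
    h.assign_apply (Nat.succ_le_of_lt hn : n + 1 ≤ Nt), h.assign_apply hn.le, Pi.add_apply,
    Pi.sub_apply, Pi.smul_apply,
    Sum.elim_inl, Sum.elim_comp_inl, Sum.elim_comp_inr, smul_mulVec, mulVec_sub, zero_mulVec,
    Pi.zero_apply, smul_eq_mul] at hstep h0 h1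
  simp only [mid, mulVec_sub, mulVec_smul, mulVec_add, Pi.add_apply, Pi.sub_apply,
    Pi.smul_apply, smul_eq_mul] at hstep ⊢
  simp only [mulVec, dotProduct, submatrix_apply, id] at hstep h0 h1 ⊢
  linear_combination hstep + h0 - h1

theorem energy_balance (h : S.IsDualSolution Δt Nt u₁ u₂ e₁ e₂) (hΔt : Δt ≠ 0) {n : ℕ}
    (hn : n < Nt) :
    (S.hamiltonianDual (e₁ (n + 1)) (e₂ (n + 1)) - S.hamiltonianDual (e₁ n) (e₂ n)) / Δt =
      S.powerDual Δt u₁ u₂ e₁ e₂ n := by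
  have hu : mid u₁ n = fun l => mid e₁ n (S.Vq'.incl S.Γ₁q l) := by
    rw [mid, h.assign_apply (Nat.succ_le_of_lt hn : n + 1 ≤ Nt), h.assign_apply hn.le]
    rfl
  have hM := S.Vq'.dotProduct_rest_add_incl S.Γ₁q (mid e₁ n) (S.MC *ᵥ (e₁ (n + 1) - e₁ n))
  have hD := S.Vq'.dotProduct_rest_add_incl S.Γ₁q (mid e₁ n) (S.Dqᵀ *ᵥ mid e₂ n)
  -- Here `Γ₁` is prescribed, so the two sets exchange roles and the rows in `Γ₂` remain.
  have hB := Mesh.FEBasis.dotProduct_trace_transpose_mul S.Vq' S.isCompl_q.symm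
    ((Mesh.bdryMatrix (Nat.add_comm b a) S.Vq' S.Vp').submatrix id Subtype.val)
    (mid e₁ n) (mid u₂ n)
  have hT : mid e₁ n ⬝ᵥ (S.Dqᵀ *ᵥ mid e₂ n) = mid e₂ n ⬝ᵥ (S.Dq *ᵥ mid e₁ n) := by
    rw [dotProduct_mulVec, vecMul_transpose, dotProduct_comm]
  have hΨ : (-1 : ℝ) ^ (a * b) • (Mesh.bdryMatrix (Nat.add_comm b a) S.Vq' S.Vp').submatrix
      (Subtype.val : S.Γ₂q → _) (Subtype.val : S.Γ₂p → _) = S.Psi₂ᵀ :=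
    congrArg (fun A : Matrix S.Vq'.BdryIdx S.Vp'.BdryIdx ℝ =>
      A.submatrix (Subtype.val : S.Γ₂q → _) (Subtype.val : S.Γ₂p → _)) S.smul_bdryMatrix
  have hB' : (fun i : S.FreeQ => mid e₁ n i.1) ⬝ᵥ
      ((-1 : ℝ) ^ (a * b) • S.Bp.submatrix Subtype.val Subtype.val *ᵥ mid u₂ n) =
      mid u₂ n ⬝ᵥ (S.Psi₂ *ᵥ fun l => mid e₁ n (S.Vq'.incl S.Γ₂q l)) := by
    refine (dotProduct_smul _ _ _).trans ((congrArg _ hB).trans ?_)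
    -- The sign is moved onto the block of `Ψ^{p-1}`, which makes it `Psi₂ᵀ`; transposing then
    -- exchanges the two vectors.
    rw [← dotProduct_smul, submatrix_submatrix, ← smul_mulVec]
    refine (congrArg (fun A => _ ⬝ᵥ (A *ᵥ mid u₂ n)) hΨ).trans ?_
    rw [dotProduct_mulVec, vecMul_transpose, dotProduct_comm]
  have hc : (fun l => mid e₁ n (S.Vq'.incl S.Γ₁q l)) ⬝ᵥ S.collocatedQ Δt e₁ e₂ n =
      Δt⁻¹ * ((fun l => mid e₁ n (S.Vq'.incl S.Γ₁q l)) ⬝ᵥ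
        (fun l => (S.MC *ᵥ (e₁ (n + 1) - e₁ n)) (S.Vq'.incl S.Γ₁q l))) -
      (fun l => mid e₁ n (S.Vq'.incl S.Γ₁q l)) ⬝ᵥ
        (fun l => (S.Dqᵀ *ᵥ mid e₂ n) (S.Vq'.incl S.Γ₁q l)) := by
    rw [collocatedQ, mulVec_smul, dotProduct_sub, dotProduct_smul, smul_eq_mul]
    rfl
  rw [hamiltonianDual_sub, ← hM, h.mulVec_sub_snd hn, h.mulVec_sub_fst hn, powerDual, outputQ,
    hu, hc, Mesh.FEBasis.trace_mulVec,
    dotProduct_smul, dotProduct_smul, dotProduct_add, hB', ← hT, ← hD, div_eq_iff hΔt]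
  simp only [smul_eq_mul]
  linear_combination -((fun l => mid e₁ n (S.Vq'.incl S.Γ₁q l)) ⬝ᵥ
    (fun l => (S.MC *ᵥ (e₁ (n + 1) - e₁ n)) (S.Vq'.incl S.Γ₁q l))) * mul_inv_cancel₀ hΔt

end IsDualSolution
end Discretization
end DualField

end

theorem mainTheorem4 {a b : ℕ} (S : DualField.Discretization a b)
    (Tend Δt : ℝ) (Nt : ℕ) (hTend : 0 < Tend) (hNt : 0 < Nt) (hΔt : Δt = Tend / Nt)
    (u₁ : ℕ → S.Γ₁q → ℝ) (u₂ : ℕ → S.Γ₂p → ℝ) :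
    (∀ (e₁ : ℕ → Fin S.Vp.N → ℝ) (e₂ : ℕ → Fin S.Vp'.N → ℝ),
      S.IsPrimalSolution Δt Nt u₁ u₂ e₁ e₂ → ∀ n < Nt,
        (S.hamiltonianPrimal (e₁ (n + 1)) (e₂ (n + 1)) - S.hamiltonianPrimal (e₁ n) (e₂ n)) / Δt
          = S.powerPrimal Δt u₁ u₂ e₁ e₂ n) ∧
    (∀ (e₁ : ℕ → Fin S.Vq'.N → ℝ) (e₂ : ℕ → Fin S.Vq.N → ℝ),
      S.IsDualSolution Δt Nt u₁ u₂ e₁ e₂ → ∀ n < Nt,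
        (S.hamiltonianDual (e₁ (n + 1)) (e₂ (n + 1)) - S.hamiltonianDual (e₁ n) (e₂ n)) / Δt
          = S.powerDual Δt u₁ u₂ e₁ e₂ n) := by
  have hne : Δt ≠ 0 := by
    rw [hΔt]
    exact (div_pos hTend (Nat.cast_pos.2 hNt)).ne'
  exact ⟨fun _ _ h _ hn => h.energy_balance hne hn, fun _ _ h _ hn => h.energy_balance hne hn⟩
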